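/- Throughout, a monoid is commutative and written multiplicatively, with identity element; $H^\times$ is its group of units, $H_{\mathrm{red}}=\{aH^\times : a\in H\}$, and $\mathbb N$ denotes the positive integers. For $a\in H$, $\mathsf L(a)\subset\mathbb N_0$ is the set of all $\ell$ such that $aH^\times$ is a product of $\ell$ atoms (irreducible non-units) of $H_{\mathrm{red}}$, and $\mathcal L(H)=\{\mathsf L(a): a\in H\}$. $H$ is *atomic* if all $\mathsf L(a)$ are nonempty, a *BF-monoid* if all $\mathsf L(a)$ are finite and nonempty, and *half-factorial* if $|\mathsf L(a)|=1$ for all $a\in H$. For $L\subset\mathbb N_0$ put $\rho(L)=\sup(L\cap\mathbb N)/\min(L\cap\mathbb N)\in[1,\infty]$, and $\rho(L)=1$ if $L\cap\mathbb N=\emptyset$. A *Krull monoid* is a cancellative monoid $H$ having a homomorphism $\varphi$ into a free abelian monoid such that $\varphi(a)\mid\varphi(b)$ implies $a\mid b$ for all $a,b\in H$. A *transfer homomorphism* is a homomorphism $\theta\colon H\to B$ of atomic monoids such that $B=\theta(H)B^\times$, $\theta^{-1}(B^\times)=H^\times$, and whenever $\theta(u)=bc$ with $u\in H$ and $b,c\in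 B$, there are $v,w\in H$ with $u=vw$, $\theta(v)\in bB^\times$ and $\theta(w)\in cB^\times$. $H$ is *transfer Krull* if it has a transfer homomorphism to a Krull monoid. A monoid $H$ is *primary* if it is cancellative, $H\neq H^\times$, and for all $a,b\in H\setminus H^\times$ there is $n\in\mathbb N$ with $b^n\in aH$. It is *strongly primary* if it is cancellative, $H\neq H^\times$, and for every $a\in H\setminus H^\times$ there is $n\in\mathbb N$ with $(H\setminus H^\times)^n\subset aH$; the smallest such $n$ is denoted by $\mathcal M(a)$. **Lemma.** Let $H$ be a primary monoid. 1. $H$ is a Krull monoid if and only if $H=H^\times\times H_0$ for some submonoid $H_0\subset H$ with $H_0\cong(\mathbb N_0,+)$. 2. If $H$ is strongly primary, then $H$ is a BF-monoid, and $\max\mathsf L(a)\le\mathcal M(a)$ for every $a\in H\setminus H^\times$. 3. Let $H$ be strongly primary. If $H$ is not half-factorial, then there is a rational number $\beta>1$ such that $\rho(L)\ge\beta$ for all $L\in\mathcal L(H)$ with $\rho(L)\neq1$. Moreover, $H$ is transfer Krull if and only if it is half-factorial. -/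

import Mathlib

open scoped Pointwise ENNReal

universe u

namespace FactorizationTheory

section Arithmetic

variable {H : Type u} [CommMonoid H]

/-- The set `Z(a)` of factorizations of `a`: the formal products (finite multisets) of atoms of the
associated reduced monoid `H_red = {aHˣ : a ∈ H}` (in Mathlib `Associates H`) whose value in
`H_red` is `aHˣ`. Atoms are irreducible non-units. -/
def factorizations (a : H) : Set (Multiset (Associates H)) :=
  {z | (∀ p ∈ z, Irreducible p) ∧ z.prod = Associates.mk a}

/-- The set of lengths `L(a) = {|z| : z ∈ Z(a)} ⊆ ℕ₀`. -/
def lengthSet (a : H) : Set ℕ :=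
  Multiset.card '' factorizations a

variable (H)

/-- The system of sets of lengths `𝓛(H) = {L(a) : a ∈ H}`. -/
def lengthSystem : Set (Set ℕ) :=
  Set.range fun a : H => lengthSet a

/-- `H` is atomic: every element has a factorization. -/
def IsAtomicMonoid : Prop :=
  ∀ a : H, (factorizations a).Nonempty

/-- `H` is half-factorial: `|L(a)| = 1` for all `a`. -/
def IsHalfFactorial : Prop :=
  ∀ a : H, (lengthSet a).encard = 1

/-- `H` is a BF-monoid: `L(a)` is finite and nonempty for all `a`. -/
def IsBF : Prop :=
  ∀ a : H, (lengthSet a).Finite ∧ (lengthSet a).Nonempty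

end Arithmetic

open Classical in
/-- The elasticity `ρ(L) = sup (L ∩ ℕ) / min (L ∩ ℕ) ∈ [1, ∞]` of `L ⊆ ℕ₀`, where `ℕ` is the set
of positive integers, with the convention `ρ(L) = 1` if `L ∩ ℕ = ∅`. -/
noncomputable def elasticity (L : Set ℕ) : ℝ≥0∞ :=
  if (L ∩ {n | 0 < n}).Nonempty then
    (⨆ n ∈ L ∩ {n | 0 < n}, (n : ℝ≥0∞)) / ((sInf (L ∩ {n | 0 < n}) : ℕ) : ℝ≥0∞)
  else 1

section Krull

/-- A divisor homomorphism: `φ(a) ∣ φ(b)` implies `a ∣ b`. -/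
def IsDivisorHom {H D : Type*} [CommMonoid H] [CommMonoid D] (φ : H →* D) : Prop :=
  ∀ a b : H, φ a ∣ φ b → a ∣ b

/-- A Krull monoid: a cancellative monoid with a divisor homomorphism into a free abelian
monoid `𝓕(P)`, written multiplicatively. (Up to a bijection, the set of those `p ∈ P` that occur
in an image lives in the universe of `H`, so letting `P` range over `Type u` is no restriction.) -/
structure IsKrull (H : Type u) [CommMonoid H] : Prop where
  cancel : IsCancelMul H
  exists_divisorHom : ∃ (P : Type u) (φ : H →* Multiplicative (P →₀ ℕ)), IsDivisorHom φ

/-- A transfer homomorphism `θ : H → B` between atomic monoids. -/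
structure IsTransferHom {H B : Type*} [CommMonoid H] [CommMonoid B] (θ : H →* B) : Prop where
  atomic_source : IsAtomicMonoid H
  atomic_target : IsAtomicMonoid B
  /-- `B = θ(H) Bˣ` -/
  surjective_up_to_units : ∀ b : B, ∃ (a : H) (ε : Bˣ), b = θ a * ε
  /-- `θ⁻¹(Bˣ) = Hˣ` -/
  isUnit_iff : ∀ a : H, IsUnit (θ a) ↔ IsUnit a
  /-- Factorizations of `θ(u)` into two factors lift, up to associates. -/
  lift_mul : ∀ (u : H) (b c : B), θ u = b * c →
    ∃ v w : H, u = v * w ∧ Associated (θ v) b ∧ Associated (θ w) c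

/-- A transfer Krull monoid: there is a transfer homomorphism to a Krull monoid `B`. (One may pass
to the reduced monoid of `B`, which is an image of `H`, so that `B : Type u` is no restriction.) -/
def IsTransferKrull (H : Type u) [CommMonoid H] : Prop :=
  ∃ (B : Type u) (_ : CommMonoid B) (θ : H →* B), IsKrull B ∧ IsTransferHom θ

end Krull

section Primary

variable (H : Type u) [CommMonoid H]

/-- A primary monoid: cancellative, `H ≠ Hˣ`, and for all non-units `a, b` there is a positive
`n` with `b ^ n ∈ aH`. -/
structure IsPrimary : Prop where
  cancel : IsCancelMul H
  exists_nonunit : ∃ a : H, ¬ IsUnit a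
  dvd_pow : ∀ a b : H, ¬ IsUnit a → ¬ IsUnit b → ∃ n : ℕ, 0 < n ∧ a ∣ b ^ n

/-- A strongly primary monoid: cancellative, `H ≠ Hˣ`, and for every non-unit `a` there is a
positive `n` with `(H ∖ Hˣ) ^ n ⊆ aH` (`n`-fold product of sets). -/
structure IsStronglyPrimary : Prop where
  cancel : IsCancelMul H
  exists_nonunit : ∃ a : H, ¬ IsUnit a
  pow_subset : ∀ a : H, ¬ IsUnit a → ∃ n : ℕ, 0 < n ∧ (nonunits H) ^ n ⊆ {x | a ∣ x}

variable {H}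

/-- `𝓜(a)`: the smallest positive `n` with `(H ∖ Hˣ) ^ n ⊆ aH`. -/
noncomputable def primaryExponent (a : H) : ℕ :=
  sInf {n : ℕ | 0 < n ∧ (nonunits H) ^ n ⊆ {x | a ∣ x}}

end Primary

end FactorizationTheory

open FactorizationTheory

namespace FactorizationTheory

/-! ### Lengths of factorizations. -/

section Factorizations

variable {H : Type u} [CommMonoid H]

/-! In a primary monoid all non-units divide powers of one another, so under a divisor homomorphism
they have the same support. Taking the extremal ratio of two value vectors shows that these vectors
are even proportional, so one coordinate decides divisibility and, up to units, `H` consists of the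
powers of one element.

In a strongly primary monoid a long product of non-units is divisible by `a`, which bounds the
lengths of `a` by cancellation. If `a` has two lengths, a high power of `a` divides any element of
large minimal length `n`, and refactoring that power lengthens a factorization by an amount linear
in `n` (`exists_add_le_mem_lengthSet`). This gives the gap in the elasticities.

A transfer homomorphism carries primariness to its Krull target, where lengths are unique by the
first part. Conversely, in the half-factorial case the length function is a transfer homomorphism.
-/

theorem irreducible_associates_mk {a : H} : Irreducible (Associates.mk a) ↔ Irreducible a := by
  simp only [irreducible_iff, Associates.isUnit_mk, Associates.forall_associated,
    Associates.mk_mul_mk, Associates.mk_eq_mk_iff_associated, Associated.comm (x := a)]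
  refine Iff.rfl.and ⟨fun h x y e => h _ _ (e ▸ Associated.refl _), ?_⟩
  rintro h x y ⟨u, rfl⟩
  simpa using h (mul_assoc x y (u : H))

/-- Replaces factorizations in the reduced monoid by multisets of atoms of `H`, with product taken
up to associates. -/
theorem mem_lengthSet_iff {a : H} {n : ℕ} :
    n ∈ lengthSet a ↔
      ∃ s : Multiset H, (∀ p ∈ s, Irreducible p) ∧ Associated s.prod a ∧ s.card = n := by
  constructor
  · rintro ⟨z, ⟨hz, hza⟩, rfl⟩
    obtain ⟨s, rfl⟩ := Multiset.map_surjective_of_surjective Associates.mk_surjective z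
    refine ⟨s, fun p hp => irreducible_associates_mk.1 (hz _ (Multiset.mem_map_of_mem _ hp)), ?_,
      (Multiset.card_map _ _).symm⟩
    rwa [Associates.prod_mk, Associates.mk_eq_mk_iff_associated] at hza
  · rintro ⟨s, hs, hsa, rfl⟩
    refine ⟨s.map Associates.mk, ⟨?_, ?_⟩, Multiset.card_map _ _⟩
    · intro p hp
      obtain ⟨q, hq, rfl⟩ := Multiset.mem_map.1 hp
      exact irreducible_associates_mk.2 (hs q hq)
    · rwa [Associates.prod_mk, Associates.mk_eq_mk_iff_associated]

theorem isAtomicMonoid_iff : IsAtomicMonoid H ↔ ∀ a : H, (lengthSet a).Nonempty :=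
  forall_congr' fun _ => Set.image_nonempty.symm

theorem add_mem_lengthSet_mul {a b : H} {m n : ℕ} (hm : m ∈ lengthSet a) (hn : n ∈ lengthSet b) :
    m + n ∈ lengthSet (a * b) := by
  obtain ⟨s, hs, hsa, rfl⟩ := mem_lengthSet_iff.1 hm
  obtain ⟨t, ht, htb, rfl⟩ := mem_lengthSet_iff.1 hn
  refine mem_lengthSet_iff.2 ⟨s + t, fun p hp => ?_, ?_, Multiset.card_add _ _⟩
  · exact (Multiset.mem_add.1 hp).elim (hs p) (ht p)
  · rw [Multiset.prod_add]
    exact hsa.mul_mul htb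

theorem zero_mem_lengthSet_of_isUnit {a : H} (ha : IsUnit a) : 0 ∈ lengthSet a :=
  mem_lengthSet_iff.2 ⟨0, by simp, by simpa using (associated_one_iff_isUnit.2 ha).symm, by simp⟩

theorem mul_mem_lengthSet_pow {a : H} {n : ℕ} (hn : n ∈ lengthSet a) (k : ℕ) :
    k * n ∈ lengthSet (a ^ k) := by
  induction k with
  | zero => simpa using zero_mem_lengthSet_of_isUnit (isUnit_one (M := H))
  | succ k ih =>
    rw [pow_succ, Nat.succ_mul]
    exact add_mem_lengthSet_mul ih hn

theorem eq_zero_of_isUnit_prod {s : Multiset H} (hs : ∀ p ∈ s, ¬ IsUnit p) (h : IsUnit s.prod) :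
    s = 0 :=
  Multiset.eq_zero_of_forall_notMem fun p hp =>
    hs p hp (isUnit_of_dvd_unit (Multiset.dvd_prod hp) h)

theorem lengthSet_of_isUnit {a : H} (ha : IsUnit a) : lengthSet a = {0} := by
  refine Set.eq_singleton_iff_unique_mem.2 ⟨zero_mem_lengthSet_of_isUnit ha, fun n hn => ?_⟩
  obtain ⟨s, hs, hsa, rfl⟩ := mem_lengthSet_iff.1 hn
  rw [eq_zero_of_isUnit_prod (fun p hp => (hs p hp).not_isUnit) (hsa.isUnit_iff.2 ha),
    Multiset.card_zero]

theorem isUnit_of_zero_mem_lengthSet {a : H} (h : 0 ∈ lengthSet a) : IsUnit a := by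
  obtain ⟨s, -, hsa, h0⟩ := mem_lengthSet_iff.1 h
  rw [Multiset.card_eq_zero.1 h0, Multiset.prod_zero] at hsa
  exact hsa.isUnit_iff.1 isUnit_one

theorem one_mem_lengthSet_of_irreducible {a : H} (h : Irreducible a) : 1 ∈ lengthSet a :=
  mem_lengthSet_iff.2 ⟨{a}, by simpa using h, by simp, by simp⟩

/-- An element whose factorizations into non-units have bounded length has a factorization into
atoms: one into a maximal number of non-units. -/
theorem lengthSet_nonempty_of_bddAbove {a : H} {M : ℕ}
    (h : ∀ s : Multiset H, (∀ p ∈ s, ¬ IsUnit p) → s.prod = a → s.card ≤ M) (ha : ¬ IsUnit a) :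
    (lengthSet a).Nonempty := by
  classical
  let S : Set ℕ := {n | ∃ s : Multiset H, (∀ p ∈ s, ¬ IsUnit p) ∧ s.prod = a ∧ s.card = n}
  have hne : S.Nonempty := ⟨1, {a}, by simpa using ha, by simp, by simp⟩
  have hbdd : BddAbove S := ⟨M, by rintro _ ⟨s, hs, hsa, rfl⟩; exact h s hs hsa⟩
  obtain ⟨s, hs, hsa, hcard⟩ := Nat.sSup_mem hne hbdd
  refine ⟨s.card, mem_lengthSet_iff.2 ⟨s, fun p hp => ⟨hs p hp, ?_⟩, hsa ▸ Associated.refl _, rfl⟩⟩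
  intro x y hxy
  by_contra! hc
  -- Splitting a reducible factor `p = x * y` would contradict maximality.
  have hmem : s.card + 1 ∈ S := by
    refine ⟨x ::ₘ y ::ₘ s.erase p, ?_, ?_, ?_⟩
    · intro q hq
      rcases Multiset.mem_cons.1 hq with rfl | hq
      · exact hc.1
      rcases Multiset.mem_cons.1 hq with rfl | hq
      · exact hc.2
      exact hs q (Multiset.mem_of_mem_erase hq)
    · rw [Multiset.prod_cons, Multiset.prod_cons, ← mul_assoc, ← hxy, Multiset.prod_erase hp, hsa]
    · rw [Multiset.card_cons, Multiset.card_cons, Multiset.card_erase_add_one hp]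
  have := le_csSup hbdd hmem
  omega

end Factorizations

/-! ### Primary Krull monoids. -/

section Krull

variable {H : Type u} [CommMonoid H]

theorem eq_of_associated_pow [IsCancelMul H] {π : H} (hπ : ¬ IsUnit π) {m n : ℕ}
    (h : Associated (π ^ m) (π ^ n)) : m = n := by
  wlog hmn : m ≤ n generalizing m n
  · exact (this h.symm (le_of_not_ge hmn)).symm
  obtain ⟨k, rfl⟩ := Nat.exists_eq_add_of_le hmn
  obtain ⟨c, hc⟩ := h.dvd'
  rw [pow_add, mul_assoc] at hc
  have hu : IsUnit (π ^ k) := IsUnit.of_mul_eq_one c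
    (mul_left_cancel (hc.symm.trans (mul_one _).symm))
  rcases Nat.eq_zero_or_pos k with rfl | hk
  · rfl
  · exact absurd ((isUnit_pow_iff hk.ne').1 hu) hπ

/-- In a primary Krull monoid, divisibility is detected by one additive valuation. -/
theorem IsPrimary.exists_valuation (hH : IsPrimary H) (hK : IsKrull H) :
    ∃ v : H →* Multiplicative ℕ, ∀ a b, (v a).toAdd ≤ (v b).toAdd → a ∣ b := by
  have := hH.cancel
  obtain ⟨P, φ, hφ⟩ := hK.exists_divisorHom
  let f : P → H →* Multiplicative ℕ := fun p =>
    (AddMonoidHom.toMultiplicative (Finsupp.applyAddHom p)).comp φ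
  let g : H → P → ℕ := fun a p => (φ a).toAdd p
  have hmul : ∀ a b p, g (a * b) p = g a p + g b p := fun a b p => by simp [g]
  have hpow : ∀ a n p, g (a ^ n) p = n * g a p := fun a n p => by simp [g]
  have hle : ∀ a b, (∀ p, g a p ≤ g b p) → a ∣ b := by
    intro a b h
    have h' : (φ a).toAdd ≤ (φ b).toAdd := h
    obtain ⟨c, hc⟩ := le_iff_exists_add.1 h'
    exact hφ a b ⟨Multiplicative.ofAdd c, hc⟩
  have hmono : ∀ {a b}, a ∣ b → ∀ p, g a p ≤ g b p := by
    rintro a _ ⟨c, rfl⟩ p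
    rw [hmul]
    exact Nat.le_add_right _ _
  have hunit : ∀ {a}, IsUnit a → ∀ p, g a p = 0 := fun {a} ha p => by
    have h1 : g 1 p = 0 := by simp [g]
    have := hmono (isUnit_iff_dvd_one.1 ha) p
    omega
  have hsupp : ∀ {a b}, ¬ IsUnit a → ¬ IsUnit b → ∀ p, g a p = 0 → g b p = 0 := by
    intro a b ha hb p hp
    obtain ⟨n, -, hn⟩ := hH.dvd_pow b a hb ha
    have := hmono hn p
    rw [hpow, hp] at this
    omega
  have hexists : ∀ {a}, ¬ IsUnit a → ∃ p, g a p ≠ 0 := by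
    intro a ha
    by_contra! h
    exact ha (isUnit_of_dvd_one (hle a 1 fun p => by simp [h p]))
  -- Choose `p` minimizing `g a p / g b p`. Then `b ^ g a p` divides `a ^ g b p`, and the quotient
  -- `c` has value `0` at `p`. Since non-units share their support, `c` is a unit, so the two powers
  -- have equal values everywhere.
  have hprop : ∀ {a b}, ¬ IsUnit a → ¬ IsUnit b → ∀ p q, g a q * g b p = g b q * g a p := by
    intro a b ha hb
    obtain ⟨p₁, hp₁⟩ := hexists hb
    obtain ⟨p, hp, hmin⟩ := Finset.exists_min_image (φ b).toAdd.support
      (fun q => (g a q : ℚ) / g b q) ⟨p₁, Finsupp.mem_support_iff.2 hp₁⟩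
    have hbp : g b p ≠ 0 := Finsupp.mem_support_iff.1 hp
    have hcross : ∀ q, g a p * g b q ≤ g b p * g a q := by
      intro q
      by_cases hq : g b q = 0
      · simp [hq]
      have := hmin q (Finsupp.mem_support_iff.2 hq)
      rw [div_le_div_iff₀ (by positivity) (by positivity)] at this
      have : g a p * g b q ≤ g a q * g b p := by exact_mod_cast this
      rwa [mul_comm (g b p)]
    obtain ⟨c, hc⟩ := hle (b ^ g a p) (a ^ g b p) fun q => by
      rw [hpow, hpow]
      exact hcross q
    have hval : ∀ q, g b p * g a q = g a p * g b q + g c q := fun q => by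
      rw [← hpow, hc, hmul, hpow]
    have hcu : IsUnit c := by
      by_contra hcu
      have h0 : g c p = 0 := by
        have := hval p
        rw [mul_comm] at this
        omega
      exact hbp (hsupp hcu hb p h0)
    have heq : ∀ q, g b p * g a q = g a p * g b q := fun q => by
      rw [hval, hunit hcu, add_zero]
    intro r q
    refine Nat.eq_of_mul_eq_mul_left (Nat.pos_of_ne_zero hbp) ?_
    calc g b p * (g a q * g b r) = (g b p * g a q) * g b r := by ring
      _ = g b q * (g a p * g b r) := by rw [heq]; ring
      _ = g b p * (g b q * g a r) := by rw [← heq]; ring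
  obtain ⟨a₀, ha₀⟩ := hH.exists_nonunit
  obtain ⟨p₀, hp₀⟩ := hexists ha₀
  refine ⟨f p₀, fun a b hab => ?_⟩
  change g a p₀ ≤ g b p₀ at hab
  by_cases ha : IsUnit a
  · exact ha.dvd
  have hap : g a p₀ ≠ 0 := fun h => hp₀ (hsupp ha ha₀ p₀ h)
  by_cases hb : IsUnit b
  · rw [hunit hb] at hab
    omega
  refine hle a b fun q => ?_
  -- Multiplying by `g b p₀ > 0` makes the proportionality applicable.
  refine Nat.le_of_mul_le_mul_right ?_ (Nat.pos_of_ne_zero hap |>.trans_le hab)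
  rw [hprop ha hb]
  exact Nat.mul_le_mul_left _ hab

/-- A primary Krull monoid has, up to units, only the powers of one element. -/
theorem IsPrimary.exists_associated_pow (hH : IsPrimary H) (hK : IsKrull H) :
    ∃ π : H, ¬ IsUnit π ∧ ∀ a, ∃ n : ℕ, Associated (π ^ n) a := by
  obtain ⟨v, hv⟩ := hH.exists_valuation hK
  -- A non-unit of least value divides every non-unit; dividing it out lowers the value.
  obtain ⟨π, hπ, hmin⟩ := exists_minimalFor_of_wellFoundedLT (fun a : H => ¬ IsUnit a)
    (fun a => (v a).toAdd) hH.exists_nonunit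
  refine ⟨π, hπ, fun a => ?_⟩
  have hpos : 0 < (v π).toAdd := by
    rw [Nat.pos_iff_ne_zero]
    intro h
    exact hπ (isUnit_of_dvd_one (hv π 1 (by simp [h])))
  obtain ⟨k, hk⟩ : ∃ k, (v a).toAdd = k := ⟨_, rfl⟩
  induction k using Nat.strong_induction_on generalizing a with
  | _ k ih =>
    by_cases ha : IsUnit a
    · exact ⟨0, by simpa using (associated_one_iff_isUnit.2 ha).symm⟩
    have hle : (v π).toAdd ≤ (v a).toAdd := by
      rcases le_total (v π).toAdd (v a).toAdd with h | h
      · exact h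
      · exact hmin ha h
    obtain ⟨c, rfl⟩ := hv π a hle
    rw [map_mul, toAdd_mul] at hk
    obtain ⟨n, hn⟩ := ih _ (by omega) c rfl
    exact ⟨n + 1, by rw [pow_succ']; exact hn.mul_left π⟩

theorem IsPrimary.exists_direct_product (hH : IsPrimary H) (hK : IsKrull H) :
    ∃ H₀ : Submonoid H,
      Function.Bijective (fun p : Hˣ × H₀ => (p.1 : H) * (p.2 : H)) ∧
      Nonempty (H₀ ≃* Multiplicative ℕ) := by
  classical
  have := hH.cancel
  obtain ⟨π, hπ, hpow⟩ := hH.exists_associated_pow hK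
  refine ⟨Submonoid.powers π, ⟨?_, ?_⟩, ⟨(Submonoid.powLogEquiv fun m n h => ?_).symm⟩⟩
  · rintro ⟨u, _, m, rfl⟩ ⟨w, _, n, rfl⟩ h
    have h : (u : H) * π ^ m = w * π ^ n := h
    have hmn : m = n := eq_of_associated_pow hπ <|
      ((associated_unit_mul_left (π ^ m) u u.isUnit).symm.trans (h ▸ Associated.refl _)).trans
        (associated_unit_mul_left (π ^ n) w w.isUnit)
    subst hmn
    have huw : u = w := Units.ext (mul_right_cancel h)
    subst huw
    rfl
  · intro a
    obtain ⟨n, u, hu⟩ := hpow a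
    exact ⟨(u, ⟨π ^ n, n, rfl⟩), by rw [← hu]; exact mul_comm _ _⟩
  · exact eq_of_associated_pow hπ (Associated.of_eq h)

/-- The projection to `ℕ₀` is a divisor homomorphism, since the unit component never obstructs
divisibility. -/
theorem isKrull_of_direct_product [IsCancelMul H] (H₀ : Submonoid H)
    (hb : Function.Bijective (fun p : Hˣ × H₀ => (p.1 : H) * (p.2 : H)))
    (e : H₀ ≃* Multiplicative ℕ) : IsKrull H := by
  let E : Hˣ × H₀ ≃* H := MulEquiv.ofBijective ((Units.coeHom H).coprod H₀.subtype) hb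
  let ψ : H →* Multiplicative ℕ := (e.toMonoidHom.comp (MonoidHom.snd _ _)).comp E.symm.toMonoidHom
  let ι : Multiplicative ℕ →* Multiplicative (PUnit.{u + 1} →₀ ℕ) :=
    AddMonoidHom.toMultiplicative (Finsupp.singleAddHom PUnit.unit)
  refine ⟨inferInstance, PUnit, ι.comp ψ, fun a b h => ?_⟩
  obtain ⟨⟨u, x⟩, rfl⟩ := E.surjective a
  obtain ⟨⟨w, y⟩, rfl⟩ := E.surjective b
  obtain ⟨c, hc⟩ := h
  have hev : e y = e x * Multiplicative.ofAdd (c.toAdd PUnit.unit) := by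
    have := congrArg (fun z : Multiplicative (PUnit.{u + 1} →₀ ℕ) => z.toAdd PUnit.unit) hc
    apply Multiplicative.toAdd.injective
    simpa [ι, ψ] using this
  have hxy : x ∣ y := ⟨e.symm (Multiplicative.ofAdd (c.toAdd PUnit.unit)),
    e.injective (by simpa using hev)⟩
  obtain ⟨z, rfl⟩ := hxy
  refine ⟨E (u⁻¹ * w, z), ?_⟩
  rw [← map_mul]
  simp

theorem IsPrimary.isKrull_iff (hH : IsPrimary H) :
    IsKrull H ↔
      ∃ H₀ : Submonoid H,
        Function.Bijective (fun p : Hˣ × H₀ => (p.1 : H) * (p.2 : H)) ∧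
        Nonempty (H₀ ≃* Multiplicative ℕ) := by
  have := hH.cancel
  exact ⟨hH.exists_direct_product, fun ⟨H₀, hb, ⟨e⟩⟩ => isKrull_of_direct_product H₀ hb e⟩

end Krull

/-! ### Strongly primary monoids: length bounds and elasticity. -/

section StronglyPrimary

variable {H : Type u} [CommMonoid H]

theorem exists_multiset_le_card_eq {α : Type*} (s : Multiset α) (n : ℕ) (h : n ≤ s.card) :
    ∃ t ≤ s, t.card = n := by
  induction s using Quotient.inductionOn with
  | _ l => exact ⟨l.take n, (List.take_sublist n l).subperm, List.length_take_of_le h⟩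

theorem multiset_prod_mem_nonunits_pow {s : Multiset H} (hs : ∀ p ∈ s, ¬ IsUnit p) :
    s.prod ∈ nonunits H ^ s.card := by
  induction s using Multiset.induction_on with
  | empty => simp
  | cons p s ih =>
    rw [Multiset.prod_cons, Multiset.card_cons, pow_succ']
    exact Set.mul_mem_mul (hs p (Multiset.mem_cons_self p s))
      (ih fun q hq => hs q (Multiset.mem_cons_of_mem hq))

namespace IsStronglyPrimary

theorem primaryExponent_spec (hS : IsStronglyPrimary H) {a : H} (ha : ¬ IsUnit a) :
    0 < primaryExponent a ∧ nonunits H ^ primaryExponent a ⊆ {x | a ∣ x} :=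
  Nat.sInf_mem (hS.pow_subset a ha)

theorem dvd_prod (hS : IsStronglyPrimary H) {a : H} (ha : ¬ IsUnit a) {s : Multiset H}
    (hs : ∀ p ∈ s, ¬ IsUnit p) (hcard : s.card = primaryExponent a) : a ∣ s.prod :=
  (hS.primaryExponent_spec ha).2 (hcard ▸ multiset_prod_mem_nonunits_pow hs)

theorem pow_dvd_prod (hS : IsStronglyPrimary H) {a : H} (ha : ¬ IsUnit a) (k : ℕ) {s : Multiset H}
    (hs : ∀ p ∈ s, ¬ IsUnit p) (hcard : k * primaryExponent a ≤ s.card) : a ^ k ∣ s.prod := by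
  induction k generalizing s with
  | zero => simp
  | succ k ih =>
    rw [Nat.succ_mul] at hcard
    obtain ⟨t, hts, ht⟩ := exists_multiset_le_card_eq s (primaryExponent a) (by omega)
    obtain ⟨r, rfl⟩ := Multiset.le_iff_exists_add.1 hts
    rw [Multiset.card_add] at hcard
    rw [Multiset.prod_add, pow_succ']
    exact mul_dvd_mul (hS.dvd_prod ha (fun p hp => hs p (Multiset.mem_add.2 (Or.inl hp))) ht)
      (ih (fun p hp => hs p (Multiset.mem_add.2 (Or.inr hp))) (by omega))

/-- With more factors, `primaryExponent a` of them would already form a multiple of `a`; cancelling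
makes the product of the others a unit, so there are no others. -/
theorem card_le_primaryExponent (hS : IsStronglyPrimary H) {a : H} (ha : ¬ IsUnit a)
    {s : Multiset H} (hs : ∀ p ∈ s, ¬ IsUnit p) (hsa : s.prod ∣ a) : s.card ≤ primaryExponent a := by
  have := hS.cancel
  by_contra! hlt
  obtain ⟨t, hts, ht⟩ := exists_multiset_le_card_eq s (primaryExponent a) hlt.le
  obtain ⟨r, rfl⟩ := Multiset.le_iff_exists_add.1 hts
  obtain ⟨c, hc⟩ := hsa.trans (hS.dvd_prod ha
    (fun p hp => hs p (Multiset.mem_add.2 (Or.inl hp))) ht)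
  rw [Multiset.prod_add, mul_assoc] at hc
  have hr : IsUnit r.prod := IsUnit.of_mul_eq_one c
    (mul_left_cancel (hc.symm.trans (mul_one _).symm))
  have hr0 := eq_zero_of_isUnit_prod (fun p hp => hs p (Multiset.mem_add.2 (Or.inr hp))) hr
  rw [hr0, add_zero, ht] at hlt
  exact lt_irrefl _ hlt

theorem le_primaryExponent (hS : IsStronglyPrimary H) {a : H} (ha : ¬ IsUnit a) {l : ℕ}
    (hl : l ∈ lengthSet a) : l ≤ primaryExponent a := by
  obtain ⟨s, hs, hsa, rfl⟩ := mem_lengthSet_iff.1 hl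
  exact hS.card_le_primaryExponent ha (fun p hp => (hs p hp).not_isUnit) hsa.dvd

theorem isBF (hS : IsStronglyPrimary H) : IsBF H := by
  intro a
  by_cases ha : IsUnit a
  · rw [lengthSet_of_isUnit ha]
    exact ⟨Set.finite_singleton _, Set.singleton_nonempty _⟩
  · exact ⟨(Set.finite_Iic (primaryExponent a)).subset fun l => hS.le_primaryExponent ha,
      lengthSet_nonempty_of_bddAbove
        (fun s hs hsa => hS.card_le_primaryExponent ha hs hsa.dvd) ha⟩

theorem exists_irreducible (hS : IsStronglyPrimary H) : ∃ p : H, Irreducible p := by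
  obtain ⟨a, ha⟩ := hS.exists_nonunit
  obtain ⟨n, hn⟩ := (hS.isBF a).2
  obtain ⟨s, hs, hsa, -⟩ := mem_lengthSet_iff.1 hn
  obtain ⟨p, hp⟩ := Multiset.exists_mem_of_ne_zero (s := s) (by
    rintro rfl
    exact ha (hsa.isUnit_iff.1 isUnit_one))
  exact ⟨p, hs p hp⟩

/-- If `a` has lengths `s < t`, then an element of length `n` has a length at least
`n + k` whenever `n` is its minimal length and `k𝓜(a) ≤ n`. -/
theorem exists_add_le_mem_lengthSet (hS : IsStronglyPrimary H) {a b : H} (ha : ¬ IsUnit a)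
    {s t n k : ℕ} (hs : s ∈ lengthSet a) (ht : t ∈ lengthSet a) (hst : s < t) (hn : n ∈ lengthSet b)
    (hmin : ∀ m ∈ lengthSet b, n ≤ m) (hk : k * primaryExponent a ≤ n) :
    ∃ m ∈ lengthSet b, n + k ≤ m := by
  obtain ⟨z, hz, hzb, rfl⟩ := mem_lengthSet_iff.1 hn
  -- Write `b = a ^ k * c` and let `r` be a length of `c`. Minimality gives `n ≤ k * s + r`, while
  -- `k * t + r` exceeds that sum by at least `k`.
  obtain ⟨c, hc⟩ := (hS.pow_dvd_prod ha k (fun p hp => (hz p hp).not_isUnit) hk).trans hzb.dvd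
  obtain ⟨r, hr⟩ := (hS.isBF c).2
  have h1 := hmin _ (hc ▸ add_mem_lengthSet_mul (mul_mem_lengthSet_pow hs k) hr)
  refine ⟨k * t + r, hc ▸ add_mem_lengthSet_mul (mul_mem_lengthSet_pow ht k) hr, ?_⟩
  have : k * (s + 1) ≤ k * t := Nat.mul_le_mul_left k hst
  rw [Nat.mul_succ] at this
  omega

theorem exists_lt_of_not_isHalfFactorial (hS : IsStronglyPrimary H) (h : ¬ IsHalfFactorial H) :
    ∃ a : H, ¬ IsUnit a ∧ ∃ s ∈ lengthSet a, ∃ t ∈ lengthSet a, s < t := by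
  obtain ⟨a, ha⟩ := not_forall.1 h
  obtain ⟨s, hs, t, ht, hst⟩ : (lengthSet a).Nontrivial :=
    (Set.one_lt_encard_iff_nontrivial).1 <| lt_of_le_of_ne
      (Set.one_le_encard_iff_nonempty.2 (hS.isBF a).2) (Ne.symm ha)
  refine ⟨a, fun hu => ?_, ?_⟩
  · rw [lengthSet_of_isUnit hu] at hs ht
    exact hst (hs.trans ht.symm)
  · rcases hst.lt_or_gt with h | h
    · exact ⟨s, hs, t, ht, h⟩
    · exact ⟨t, ht, s, hs, h⟩

end IsStronglyPrimary

theorem ofReal_le_elasticity {L : Set ℕ} {n m : ℕ} {β : ℝ} (hn : 0 < n)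
    (hmin : IsLeast (L ∩ {n | 0 < n}) n) (hm : m ∈ L) (hnm : β * n ≤ m) (hβ : 0 < β) :
    ENNReal.ofReal β ≤ elasticity L := by
  have hm0 : 0 < m := by
    have : (0 : ℝ) < m := lt_of_lt_of_le (by positivity) hnm
    exact_mod_cast this
  rw [elasticity, if_pos ⟨n, hmin.1⟩, hmin.csInf_eq,
    ENNReal.le_div_iff_mul_le (Or.inl (by exact_mod_cast hn.ne'))
      (Or.inl (ENNReal.natCast_ne_top n))]
  calc ENNReal.ofReal β * n = ENNReal.ofReal (β * n) := by
        rw [ENNReal.ofReal_mul hβ.le, ENNReal.ofReal_natCast]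
    _ ≤ ENNReal.ofReal m := ENNReal.ofReal_le_ofReal hnm
    _ = m := ENNReal.ofReal_natCast m
    _ ≤ _ := le_iSup₂ (f := fun (n : ℕ) (_ : n ∈ L ∩ {n | 0 < n}) => (n : ℝ≥0∞)) m ⟨hm, hm0⟩

theorem elasticity_singleton (n : ℕ) : elasticity {n} = 1 := by
  rw [elasticity]
  split_ifs with h
  · obtain ⟨m, rfl, hm⟩ := h
    have hm : 0 < m := hm
    have : ({m} ∩ {n | 0 < n} : Set ℕ) = {m} :=
      Set.inter_eq_left.2 (Set.singleton_subset_iff.2 hm)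
    rw [this, csInf_singleton, iSup_singleton]
    exact ENNReal.div_self (by exact_mod_cast hm.ne') (ENNReal.natCast_ne_top m)
  · rfl

theorem IsStronglyPrimary.exists_elasticity_bound (hS : IsStronglyPrimary H)
    (hHF : ¬ IsHalfFactorial H) :
    ∃ β : ℚ, 1 < β ∧
      ∀ L ∈ lengthSystem H, elasticity L ≠ 1 → ENNReal.ofReal (β : ℝ) ≤ elasticity L := by
  obtain ⟨a, ha, s, hs, t, ht, hst⟩ := hS.exists_lt_of_not_isHalfFactorial hHF
  obtain ⟨M, hM⟩ : ∃ M, primaryExponent a = M := ⟨_, rfl⟩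
  have hM0 : 0 < M := hM ▸ (hS.primaryExponent_spec ha).1
  -- The factor `2` absorbs the rounding in `n / M`: for `n ≥ M` the floor is at least `n / (2 *
  -- M)`. For `n < M` any second length gives `k = 1`, which also suffices.
  refine ⟨1 + 1 / (2 * M), lt_add_of_pos_right _ (by positivity), ?_⟩
  rintro _ ⟨b, rfl⟩ hρ
  change elasticity (lengthSet b) ≠ 1 at hρ
  change _ ≤ elasticity (lengthSet b)
  have hb : ¬ IsUnit b := fun hu => hρ (by rw [lengthSet_of_isUnit hu, elasticity_singleton])
  obtain ⟨n, hn, hmin⟩ : ∃ n ∈ lengthSet b, ∀ m ∈ lengthSet b, n ≤ m :=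
    ⟨_, Nat.sInf_mem (hS.isBF b).2, fun m hm => Nat.sInf_le hm⟩
  have hn0 : 0 < n := Nat.pos_of_ne_zero fun h => hb (isUnit_of_zero_mem_lengthSet (h ▸ hn))
  obtain ⟨k, m, hm, hkm, hnk⟩ : ∃ k : ℕ, ∃ m ∈ lengthSet b, n + k ≤ m ∧ n ≤ 2 * M * k := by
    rcases lt_or_ge n M with hlt | hge
    · obtain ⟨m, hm, hne⟩ : ∃ m ∈ lengthSet b, m ≠ n := by
        by_contra! h
        exact hρ (by rw [Set.eq_singleton_iff_unique_mem.2 ⟨hn, h⟩, elasticity_singleton])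
      exact ⟨1, m, hm, lt_of_le_of_ne (hmin m hm) hne.symm, by omega⟩
    · obtain ⟨m, hm, hkm⟩ := hS.exists_add_le_mem_lengthSet ha hs ht hst hn hmin
        (k := n / M) (hM ▸ Nat.div_mul_le_self n M)
      refine ⟨n / M, m, hm, hkm, ?_⟩
      have h1 : n < M * (n / M + 1) := Nat.lt_mul_div_succ n hM0
      have h2 : M * 1 ≤ M * (n / M) := Nat.mul_le_mul_left M (Nat.div_pos hge hM0)
      rw [Nat.mul_succ] at h1
      rw [mul_assoc]
      omega
  refine ofReal_le_elasticity hn0 ⟨⟨hn, hn0⟩, fun m hm => hmin m hm.1⟩ hm ?_ ?_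
  · push_cast
    have h1 : (n : ℝ) + k ≤ m := by exact_mod_cast hkm
    have h2 : (n : ℝ) ≤ 2 * M * k := by exact_mod_cast hnk
    have hMR : (0 : ℝ) < 2 * M := by positivity
    have h3 : (n : ℝ) / (2 * M) ≤ k := by
      rw [div_le_iff₀ hMR]
      linarith
    calc (1 + 1 / (2 * (M : ℝ))) * n = n + n / (2 * M) := by ring
      _ ≤ m := by linarith
  · push_cast
    positivity

end StronglyPrimary

/-! ### Transfer homomorphisms and half-factoriality. -/

section Transfer

variable {H B : Type u} [CommMonoid H] [CommMonoid B]

theorem IsTransferHom.irreducible_map {θ : H →* B} (hθ : IsTransferHom θ) {p : H}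
    (hp : Irreducible p) : Irreducible (θ p) := by
  refine ⟨fun h => hp.not_isUnit ((hθ.isUnit_iff p).1 h), fun b c hbc => ?_⟩
  obtain ⟨v, w, hvw, hv, hw⟩ := hθ.lift_mul p b c hbc
  exact (hp.isUnit_or_isUnit hvw).imp (fun h => hv.isUnit_iff.1 ((hθ.isUnit_iff v).2 h))
    fun h => hw.isUnit_iff.1 ((hθ.isUnit_iff w).2 h)

/-- This inclusion is enough to pull uniqueness of lengths back from the target. -/
theorem IsTransferHom.lengthSet_subset {θ : H →* B} (hθ : IsTransferHom θ) (a : H) :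
    lengthSet a ⊆ lengthSet (θ a) := by
  intro n hn
  obtain ⟨s, hs, hsa, rfl⟩ := mem_lengthSet_iff.1 hn
  refine mem_lengthSet_iff.2 ⟨s.map θ, fun q hq => ?_, ?_, Multiset.card_map _ _⟩
  · obtain ⟨p, hp, rfl⟩ := Multiset.mem_map.1 hq
    exact hθ.irreducible_map (hs p hp)
  · rw [Multiset.prod_hom]
    exact hsa.map θ

theorem IsTransferHom.isPrimary {θ : H →* B} (hθ : IsTransferHom θ) (hH : IsPrimary H)
    (hB : IsCancelMul B) : IsPrimary B := by
  refine ⟨hB, ?_, fun b c hb hc => ?_⟩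
  · obtain ⟨a, ha⟩ := hH.exists_nonunit
    exact ⟨θ a, fun h => ha ((hθ.isUnit_iff a).1 h)⟩
  · obtain ⟨x, ε, rfl⟩ := hθ.surjective_up_to_units b
    obtain ⟨y, η, rfl⟩ := hθ.surjective_up_to_units c
    obtain ⟨n, hn, hdvd⟩ := hH.dvd_pow x y
      (fun h => hb (((hθ.isUnit_iff x).2 h).mul ε.isUnit))
      (fun h => hc (((hθ.isUnit_iff y).2 h).mul η.isUnit))
    refine ⟨n, hn, ?_⟩
    rw [Units.mul_right_dvd, mul_pow]
    exact (map_pow θ y n ▸ map_dvd θ hdvd).mul_right _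

/-- Every atom is associated to `π`, because a power with exponent other than `1` is not
irreducible. -/
theorem lengthSet_subsingleton_of_associated_pow [IsCancelMul H] {π : H} (hπ : ¬ IsUnit π)
    (hpow : ∀ a, ∃ n : ℕ, Associated (π ^ n) a) (a : H) : (lengthSet a).Subsingleton := by
  have hirr : ∀ p : H, Irreducible p → Associated p π := by
    intro p hp
    obtain ⟨n, hn⟩ := hpow p
    have h1 : n = 1 := by
      by_contra h
      exact not_irreducible_pow h ((Associated.irreducible_iff hn).2 hp)
    rw [h1, pow_one] at hn
    exact hn.symm
  have hprod : ∀ s : Multiset H, (∀ p ∈ s, Irreducible p) → Associated s.prod (π ^ s.card) := by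
    intro s
    induction s using Multiset.induction_on with
    | empty => intro; simp
    | cons p s ih =>
      intro hs
      rw [Multiset.prod_cons, Multiset.card_cons, pow_succ']
      exact (hirr p (hs p (Multiset.mem_cons_self p s))).mul_mul
        (ih fun q hq => hs q (Multiset.mem_cons_of_mem hq))
  intro m hm n hn
  obtain ⟨s, hs, hsa, rfl⟩ := mem_lengthSet_iff.1 hm
  obtain ⟨t, ht, hta, rfl⟩ := mem_lengthSet_iff.1 hn
  exact eq_of_associated_pow hπ
    ((hprod s hs).symm.trans (hsa.trans (hta.symm.trans (hprod t ht))))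

theorem IsPrimary.isHalfFactorial_of_isTransferKrull (hH : IsPrimary H) (h : IsTransferKrull H) :
    IsHalfFactorial H := by
  obtain ⟨B, _, θ, hK, hθ⟩ := h
  have := hK.cancel
  obtain ⟨π, hπ, hpow⟩ := (hθ.isPrimary hH hK.cancel).exists_associated_pow hK
  intro a
  obtain ⟨n, hn⟩ := isAtomicMonoid_iff.1 hθ.atomic_source a
  exact Set.encard_eq_one.2 ⟨n, Set.Subsingleton.eq_singleton_of_mem
    ((lengthSet_subsingleton_of_associated_pow hπ hpow (θ a)).anti (hθ.lengthSet_subset a)) hn⟩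

theorem isKrull_multiplicative_finsupp (P : Type u) : IsKrull (Multiplicative (P →₀ ℕ)) :=
  ⟨inferInstance, P, MonoidHom.id _, fun _ _ h => h⟩

theorem irreducible_ofAdd_single_one :
    Irreducible (Multiplicative.ofAdd (Finsupp.single PUnit.unit.{u + 1} (1 : ℕ))) := by
  have hu : ∀ x : Multiplicative (PUnit.{u + 1} →₀ ℕ), x.toAdd PUnit.unit = 0 → IsUnit x := by
    intro x hx
    have : x = 1 := Multiplicative.toAdd.injective (Finsupp.ext fun _ => hx)
    exact this ▸ isUnit_one
  refine ⟨fun h => ?_, fun x y hxy => ?_⟩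
  · obtain ⟨c, hc⟩ := h.exists_right_inv
    have := congrArg (fun z : Multiplicative (PUnit.{u + 1} →₀ ℕ) => z.toAdd PUnit.unit) hc
    simp at this
  · have := congrArg (fun z : Multiplicative (PUnit.{u + 1} →₀ ℕ) => z.toAdd PUnit.unit) hxy
    simp only [toAdd_ofAdd, Finsupp.single_eq_same, toAdd_mul, Finsupp.add_apply] at this
    rcases Nat.eq_zero_or_pos (x.toAdd PUnit.unit) with h | h
    · exact Or.inl (hu x h)
    · exact Or.inr (hu y (by omega))

theorem isAtomicMonoid_multiplicative_finsupp_punit :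
    IsAtomicMonoid (Multiplicative (PUnit.{u + 1} →₀ ℕ)) := by
  refine isAtomicMonoid_iff.2 fun a => ⟨a.toAdd PUnit.unit * 1, ?_⟩
  convert mul_mem_lengthSet_pow (one_mem_lengthSet_of_irreducible irreducible_ofAdd_single_one)
    (a.toAdd PUnit.unit) using 2
  refine Multiplicative.toAdd.injective (Finsupp.ext fun _ => ?_)
  simp

theorem isUnit_multiplicative_finsupp_iff {P : Type u} {x : Multiplicative (P →₀ ℕ)} :
    IsUnit x ↔ x = 1 := by
  refine ⟨fun h => ?_, fun h => h ▸ isUnit_one⟩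
  obtain ⟨c, hc⟩ := h.exists_right_inv
  refine Multiplicative.toAdd.injective (Finsupp.ext fun p => ?_)
  have := congrArg (fun z : Multiplicative (P →₀ ℕ) => z.toAdd p) hc
  simp only [toAdd_mul, Finsupp.add_apply, toAdd_one, Finsupp.coe_zero, Pi.zero_apply] at this ⊢
  omega

/-- In a half-factorial monoid with an atom, the length function is a transfer homomorphism to
`(ℕ₀, +)`. -/
theorem isTransferKrull_of_isHalfFactorial (hHF : IsHalfFactorial H)
    (hirr : ∃ p : H, Irreducible p) : IsTransferKrull H := by
  choose l hl using fun a => Set.encard_eq_one.1 (hHF a)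
  have hmem : ∀ a, l a ∈ lengthSet a := fun a => by rw [hl a]; exact rfl
  have huniq : ∀ {a n}, n ∈ lengthSet a → l a = n := fun {a n} h => by
    rw [hl a] at h
    exact h.symm
  let len : H →* Multiplicative ℕ :=
    { toFun := fun a => Multiplicative.ofAdd (l a)
      map_one' := congrArg Multiplicative.ofAdd (huniq (zero_mem_lengthSet_of_isUnit isUnit_one))
      map_mul' := fun a b =>
        congrArg Multiplicative.ofAdd (huniq (add_mem_lengthSet_mul (hmem a) (hmem b))) }
  let ι : Multiplicative ℕ →* Multiplicative (PUnit.{u + 1} →₀ ℕ) :=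
    AddMonoidHom.toMultiplicative (Finsupp.singleAddHom PUnit.unit)
  have hθ : ∀ a b, (ι.comp len a = b ↔ l a = b.toAdd PUnit.unit) := fun a b => by
    refine ⟨fun h => by rw [← h]; simp [ι, len], fun h => ?_⟩
    refine Multiplicative.toAdd.injective (Finsupp.ext fun _ => ?_)
    simpa [ι, len] using h
  refine ⟨_, _, ι.comp len, isKrull_multiplicative_finsupp PUnit,
    ⟨isAtomicMonoid_iff.2 fun a => ⟨l a, hmem a⟩,
      isAtomicMonoid_multiplicative_finsupp_punit, fun b => ?_, fun a => ?_, fun a b c h => ?_⟩⟩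
  -- Powers of an atom realize every length.
  · obtain ⟨p, hp⟩ := hirr
    refine ⟨p ^ b.toAdd PUnit.unit, 1, ?_⟩
    rw [Units.val_one, mul_one, eq_comm, hθ]
    simpa using huniq (mul_mem_lengthSet_pow (one_mem_lengthSet_of_irreducible hp)
      (b.toAdd PUnit.unit))
  · rw [isUnit_multiplicative_finsupp_iff, hθ]
    exact ⟨fun h => isUnit_of_zero_mem_lengthSet (by simpa [h] using hmem a),
      fun h => huniq (zero_mem_lengthSet_of_isUnit h)⟩
  · rw [hθ, toAdd_mul, Finsupp.add_apply] at h
    -- Split a factorization of `a` into blocks of the prescribed sizes; the second factor absorbs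
    -- the unit `ε`.
    obtain ⟨s, hs, hsa, hcard⟩ := mem_lengthSet_iff.1 (hmem a)
    obtain ⟨t, hts, ht⟩ := exists_multiset_le_card_eq s (b.toAdd PUnit.unit) (by omega)
    obtain ⟨r, rfl⟩ := Multiset.le_iff_exists_add.1 hts
    rw [Multiset.card_add] at hcard
    rw [Multiset.prod_add] at hsa
    obtain ⟨ε, hε⟩ := hsa
    refine ⟨t.prod, r.prod * ε, by rw [← mul_assoc, hε], Associated.of_eq ((hθ _ _).2 ?_),
      Associated.of_eq ((hθ _ _).2 ?_)⟩
    · exact huniq (mem_lengthSet_iff.2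
        ⟨t, fun p hp => hs p (Multiset.mem_add.2 (Or.inl hp)), Associated.refl _, ht⟩)
    · exact huniq (mem_lengthSet_iff.2
        ⟨r, fun p hp => hs p (Multiset.mem_add.2 (Or.inr hp)), ⟨ε, rfl⟩, by omega⟩)

end Transfer

end FactorizationTheory

theorem lemma7p1 (H : Type u) [CommMonoid H] (hH : IsPrimary H) :
    -- Krull if and only if `H = Hˣ × H₀` (internal direct product) with `H₀ ≅ (ℕ₀, +)`
    (IsKrull H ↔
      ∃ H₀ : Submonoid H,
        Function.Bijective (fun p : Hˣ × H₀ => (p.1 : H) * (p.2 : H)) ∧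
        Nonempty (H₀ ≃* Multiplicative ℕ)) ∧
    -- strongly primary monoids are BF-monoids, and `max L(a) ≤ 𝓜(a)`
    (IsStronglyPrimary H →
      IsBF H ∧ ∀ a : H, ¬ IsUnit a → ∀ ℓ ∈ lengthSet a, ℓ ≤ primaryExponent a) ∧
    -- elasticities are bounded away from `1`; transfer Krull means half-factorial
    (IsStronglyPrimary H →
      (¬ IsHalfFactorial H →
        ∃ β : ℚ, 1 < β ∧
          ∀ L ∈ lengthSystem H, elasticity L ≠ 1 → ENNReal.ofReal (β : ℝ) ≤ elasticity L) ∧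
      (IsTransferKrull H ↔ IsHalfFactorial H)) := by
  refine ⟨hH.isKrull_iff, fun hS => ⟨hS.isBF, fun a ha l hl => hS.le_primaryExponent ha hl⟩,
    fun hS => ⟨hS.exists_elasticity_bound, hH.isHalfFactorial_of_isTransferKrull, fun h =>
      isTransferKrull_of_isHalfFactorial h hS.exists_irreducible⟩⟩
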